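/- Let $(\Omega,\mathsf d)$ be a compact metric space (for instance a compact domain of an Alexandrov space with curvature bounded below), put $c(x,y)=\tfrac12\mathsf d^2(x,y)$, and let $\mathcal P(\Omega)$ be the set of Borel probability measures on $\Omega$, with the topology of weak convergence and its Borel $\sigma$-algebra. For $\mu,\rho\in\mathcal P(\Omega)$ let \[ W_2^2(\mu,\rho):=\sup\Bigl\{\int_\Omega\phi\,d\rho+\int_\Omega\psi\,d\mu\;:\;\phi,\psi\in C(\Omega),\ \phi(x)+\psi(y)\le c(x,y)\ \text{for all }x,y\in\Omega\Bigr\}. \] A pair $(\phi,\psi)$ attaining this supremum and such that $\phi=\psi^c$, where $\psi^c(x):=\inf_{y\in\Omega}\{c(x,y)-\psi(y)\}$, is called a pair of Kantorovich potentials for $(\rho,\mu)$. Let $\mathbb P$ be a Borel probability measure on $\mathcal P(\Omega)$, and let $\mu_{\mathbb P}\in\mathcal P(\Omega)$ be a Wasserstein barycenter of $\mathbb P$, that is, a minimizer over $\mu\in\mathcal P(\Omega)$ of $\int_{\mathcal P(\Omega)}W_2^2(\mu,\rho)\,d\mathbb P(\rho)$. Then there exists a $\mathbb P$-measurable map $\mathcal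 P(\Omega)\ni\rho\mapsto\psi_\rho\in C(\Omega)$ such that, setting $\phi_\rho:=\psi_\rho^c$: (i) for $\mathbb P$-a.e. $\rho\in\mathcal P(\Omega)$, $(\phi_\rho,\psi_\rho)$ is a pair of Kantorovich potentials for $(\rho,\mu_{\mathbb P})$; (ii) for every $y\in\Omega$, the function $\rho\mapsto\psi_\rho(y)$ is $\mathbb P$-integrable and $\displaystyle\int_{\mathcal P(\Omega)}\psi_\rho(y)\,d\mathbb P(\rho)=0$ (global zero-order balance). -/

import Mathlib

open MeasureTheory Topology

section KantorovichDuality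

variable {Ω : Type*} [MetricSpace Ω]

/-- The quadratic cost `c(x, y) = d(x, y)² / 2`. -/
noncomputable def cost (x y : Ω) : ℝ := dist x y ^ 2 / 2

theorem continuous_cost : Continuous fun p : Ω × Ω => cost p.1 p.2 := by
  unfold cost
  fun_prop

/-- `φ(x) + ψ(y) ≤ c(x, y)` for all `x, y`: the constraint of the dual problem. -/
def DualAdmissible (φ ψ : C(Ω, ℝ)) : Prop :=
  ∀ x y : Ω, φ x + ψ y ≤ cost x y

/-- The `c`-transform `ψᶜ(x) = inf_y (c(x, y) - ψ(y))` of a continuous function on a compact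
space, which is again a continuous function. -/
noncomputable def cTransform [CompactSpace Ω] (ψ : C(Ω, ℝ)) : C(Ω, ℝ) where
  toFun x := ⨅ y : Ω, (cost x y - ψ y)
  continuous_toFun := by
    have h : Continuous fun p : Ω × Ω => cost p.1 p.2 - ψ p.2 :=
      continuous_cost.sub (ψ.continuous.comp continuous_snd)
    have h' := isCompact_univ.continuous_sInf (f := fun x y : Ω => cost x y - ψ y) h
    simpa only [Set.image_univ, sInf_range] using h'

variable [MeasurableSpace Ω]

/-- The value of the dual functional `∫ φ dρ + ∫ ψ dμ`. -/
noncomputable def dualValue (ρ μ : ProbabilityMeasure Ω) (φ ψ : C(Ω, ℝ)) : ℝ :=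
  ∫ x, φ x ∂(ρ : Measure Ω) + ∫ y, ψ y ∂(μ : Measure Ω)

/-- `W₂²(μ, ρ)`, normalized with the cost `d² / 2` and defined by the Kantorovich dual problem:
the supremum of `∫ φ dρ + ∫ ψ dμ` over the continuous `φ, ψ` with `φ(x) + ψ(y) ≤ c(x, y)`. -/
noncomputable def wassersteinSq (μ ρ : ProbabilityMeasure Ω) : ℝ :=
  sSup {r : ℝ | ∃ φ ψ : C(Ω, ℝ), DualAdmissible φ ψ ∧ r = dualValue ρ μ φ ψ}

/-- `(φ, ψ)` is a pair of Kantorovich potentials for `(ρ, μ)`: it is optimal in the dual problem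
defining `W₂²(μ, ρ)`, and `φ = ψᶜ`. -/
structure IsKantorovichPair [CompactSpace Ω] (ρ μ : ProbabilityMeasure Ω) (φ ψ : C(Ω, ℝ)) :
    Prop where
  admissible : DualAdmissible φ ψ
  optimal : dualValue ρ μ φ ψ = wassersteinSq μ ρ
  eq_cTransform : φ = cTransform ψ

/-- The variance functional `Var_ℙ(μ) = ∫ W₂²(μ, ρ) dℙ(ρ)`. -/
noncomputable def wassersteinVar (P : ProbabilityMeasure (ProbabilityMeasure Ω))
    (μ : ProbabilityMeasure Ω) : ℝ :=
  ∫ ρ, wassersteinSq μ ρ ∂(P : Measure (ProbabilityMeasure Ω))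

/-- A Wasserstein barycenter of `ℙ` is a minimizer of the variance functional. -/
def IsWassersteinBarycenter (P : ProbabilityMeasure (ProbabilityMeasure Ω))
    (μ : ProbabilityMeasure Ω) : Prop :=
  ∀ ν : ProbabilityMeasure Ω, wassersteinVar P μ ≤ wassersteinVar P ν

/-- The set of dual values is bounded above on a compact space (so that the supremum defining
`W₂²` is a genuine one; the set contains `0`, the value of the pair `(0, 0)`). -/
theorem bddAbove_dualValue [CompactSpace Ω] [BorelSpace Ω] (μ ρ : ProbabilityMeasure Ω) :
    BddAbove {r : ℝ | ∃ φ ψ : C(Ω, ℝ), DualAdmissible φ ψ ∧ r = dualValue ρ μ φ ψ} := by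
  obtain ⟨C, hC⟩ := (isCompact_univ.image (continuous_cost (Ω := Ω))).bddAbove
  have hI : ∀ (ν : ProbabilityMeasure Ω) (f : C(Ω, ℝ)), Integrable f (ν : Measure Ω) := fun ν f =>
    f.continuous.integrable_of_hasCompactSupport (HasCompactSupport.of_compactSpace f)
  refine ⟨C, ?_⟩
  rintro _ ⟨φ, ψ, h, rfl⟩
  have hx : ∀ x, φ x + ∫ y, ψ y ∂(μ : Measure Ω) ≤ C := fun x => by
    have h2 : ∫ y, ψ y ∂(μ : Measure Ω) ≤ ∫ _y, (C - φ x) ∂(μ : Measure Ω) :=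
      integral_mono (hI μ ψ) (integrable_const _) fun y => by
        have := hC ⟨(x, y), Set.mem_univ _, rfl⟩
        have := h x y
        simp only at *
        linarith
    simp only [integral_const, probReal_univ, smul_eq_mul, one_mul] at h2
    linarith
  have h3 : ∫ x, φ x ∂(ρ : Measure Ω) ≤
      ∫ _x, (C - ∫ y, ψ y ∂(μ : Measure Ω)) ∂(ρ : Measure Ω) :=
    integral_mono (hI ρ φ) (integrable_const _) fun x => by
      have := hx x
      simp only
      linarith
  simp only [integral_const, probReal_univ, smul_eq_mul, one_mul] at h3
  unfold dualValue
  linarith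

end KantorovichDuality

/-- The σ-algebra that Mathlib puts on `𝒫(Ω)`, generated by the evaluations `ρ ↦ ρ(A)`, is the Borel
σ-algebra of the topology of weak convergence. -/
theorem borelSpace_probabilityMeasure {Ω : Type*} [MetricSpace Ω] [CompactSpace Ω]
    [MeasurableSpace Ω] [BorelSpace Ω] : BorelSpace (ProbabilityMeasure Ω) := by
  have hI : ∀ (ν : ProbabilityMeasure Ω) (f : C(Ω, ℝ)), Integrable f (ν : Measure Ω) := fun ν f =>
    f.continuous.integrable_of_hasCompactSupport (HasCompactSupport.of_compactSpace f)
  have hC : ∀ f : C(Ω, ℝ), Continuous fun ν : ProbabilityMeasure Ω => ∫ x, f x ∂(ν : Measure Ω) :=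
    fun f => ProbabilityMeasure.continuous_integral_boundedContinuousFunction
      (BoundedContinuousFunction.mkOfCompact f)
  refine ⟨le_antisymm ?_ ?_⟩
  · have key : @Measurable _ _ (borel (ProbabilityMeasure Ω)) _
        (fun ν : ProbabilityMeasure Ω => (ν : Measure Ω)) := by
      let _ : MeasurableSpace (ProbabilityMeasure Ω) := borel _
      have : BorelSpace (ProbabilityMeasure Ω) := ⟨rfl⟩
      refine Measurable.measure_of_isPiSystem_of_isProbabilityMeasure (S := {s | IsClosed s})
        (by rw [BorelSpace.measurable_eq (α := Ω), borel_eq_generateFrom_isClosed])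
        isPiSystem_isClosed fun F hF => ?_
      have hF : IsClosed F := hF
      refine measurable_of_tendsto_metrizable
        (f := fun (n : ℕ) (ν : ProbabilityMeasure Ω) =>
          ∫⁻ x, (hF.apprSeq n x : ENNReal) ∂(ν : Measure Ω)) (fun n => ?_)
        (tendsto_pi_nhds.2 fun ν =>
          HasOuterApproxClosed.tendsto_lintegral_apprSeq hF (ν : Measure Ω))
      exact (ProbabilityMeasure.continuous_lintegral_boundedContinuousFunction _).measurable
    intro s hs
    obtain ⟨t, ht, rfl⟩ := hs
    exact key ht
  · let d : ℕ → C(Ω, ℝ) := TopologicalSpace.denseSeq C(Ω, ℝ)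
    let F : ProbabilityMeasure Ω → ℕ → ℝ := fun ν n => ∫ x, d n x ∂(ν : Measure Ω)
    have hF : Continuous F := continuous_pi fun n => hC (d n)
    have hcont : ∀ ν : ProbabilityMeasure Ω,
        Continuous fun f : C(Ω, ℝ) => ∫ x, f x ∂(ν : Measure Ω) := fun ν => by
      refine (LipschitzWith.of_dist_le_mul (K := 1) fun f g => ?_).continuous
      rw [Real.dist_eq, ← integral_sub (hI ν f) (hI ν g)]
      refine (norm_integral_le_of_norm_le_const (μ := (ν : Measure Ω)) (f := fun x => f x - g x) (C := dist f g)
        (Filter.Eventually.of_forall fun x => ?_)).trans_eq ?_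
      · rw [Real.norm_eq_abs, ← Real.dist_eq]
        exact ContinuousMap.dist_apply_le_dist x
      · rw [NNReal.coe_one, one_mul, probReal_univ, mul_one]
    have hinj : Function.Injective F := by
      intro ν ν' h
      have h' := (TopologicalSpace.denseRange_denseSeq C(Ω, ℝ)).equalizer (hcont ν) (hcont ν')
        h
      apply Subtype.ext
      have := ν.2
      have := ν'.2
      exact ext_of_forall_integral_eq_of_IsFiniteMeasure fun f => congrFun h' f.toContinuousMap
    have hemb : IsClosedEmbedding F := hF.isClosedEmbedding hinj
    have hmeas : Measurable F := measurable_pi_lambda _ fun n =>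
      ((d n).continuous.stronglyMeasurable.integral_kernel (κ := ⟨fun ν : ProbabilityMeasure Ω => (ν : Measure Ω), measurable_subtype_coe⟩)).measurable
    calc borel (ProbabilityMeasure Ω) = (borel (ℕ → ℝ)).comap F := by
          rw [hemb.isInducing.eq_induced, borel_comap]
      _ ≤ _ := by
          rw [← BorelSpace.measurable_eq (α := ℕ → ℝ)]
          exact hmeas.comap_le

/-!
Write `V(ν) = ∫ W₂²(ν, ρ) dℙ(ρ)` and, for a measurable field `ρ ↦ ψ_ρ`, write
`I(ψ) = ∫∫ ψ_ρᶜ dρ dℙ(ρ)` and `Ψ = ∫ ψ_ρ dℙ(ρ) ∈ C(Ω)`, a Bochner integral. Potentials may be taken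
in the compact convex set of `diam Ω`-Lipschitz functions vanishing at a base point
(`exists_mem_normalizedPotentials_dualValue_le`), and an almost optimal one can be chosen measurably
from a countable dense set, so `V(ν)` is the supremum of `I(ψ) + ∫ Ψ dν` over all fields `ψ`
(`exists_potentialSelection_lt_of_lt_wassersteinVar`).

For every `c < min V` some field satisfies `c < I(ψ) + Ψ` everywhere on `Ω`: this is a minimax
statement, obtained from the Hahn–Banach theorem in `C(Ω)` and the Riesz representation theorem
(`exists_potentialSelection_forall_lt`). As `c` increases to `min V` such fields form decreasing
convex sets. Seen in the Hilbert space `L²(ℙ; L²(m))`, where `m` charges every open set of `Ω`, such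
a sequence of sets admits a convergent choice of elements, hence, by compactness of the set of
potentials, one converging `ℙ`-a.e. in `C(Ω)` (`exists_ae_tendsto_of_antitone_convex`). The limit
field satisfies `min V ≤ I(ψ) + Ψ` everywhere (`exists_potentialSelection_forall_le`).

Let `μ` be a barycenter. Integrating this inequality against `μ` and comparing with
`V(μ) = min V` shows that `(ψ_ρᶜ, ψ_ρ)` is optimal for `ℙ`-a.e. `ρ`, and that `Ψ ≥ ∫ Ψ dμ`
everywhere. The field `ψ_ρ - Ψ` has mean zero. It is still optimal, because
`(ψ_ρ - Ψ)ᶜ ≥ (ψ_ρ - ∫ Ψ dμ)ᶜ = ψ_ρᶜ + ∫ Ψ dμ`, so the gain in the first integral makes up for the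
loss `∫ Ψ dμ` in the second.
-/

open Filter

/-! ### The `c`-transform and normalized potentials -/

section CTransform

variable {Ω : Type*} [MetricSpace Ω]

theorem cost_comm (x y : Ω) : cost x y = cost y x := by
  simp only [cost, dist_comm]

theorem cost_nonneg (x y : Ω) : 0 ≤ cost x y := by
  unfold cost
  positivity

/-- The functions vanishing at `x₀` that are Lipschitz with constant `diam Ω`, a Lipschitz constant
of all `c`-transforms. Every `c`-concave function belongs to this set up to an additive constant,
and constants do not affect the dual functional. -/
def normalizedPotentials (x₀ : Ω) : Set C(Ω, ℝ) :=
  {ψ | ψ x₀ = 0 ∧ ∀ y y', ψ y - ψ y' ≤ Metric.diam (Set.univ : Set Ω) * dist y y'}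

theorem zero_mem_normalizedPotentials (x₀ : Ω) : 0 ∈ normalizedPotentials x₀ :=
  ⟨rfl, fun y y' => by simpa using mul_nonneg Metric.diam_nonneg dist_nonneg⟩

theorem convex_normalizedPotentials (x₀ : Ω) : Convex ℝ (normalizedPotentials x₀) := by
  rintro ψ ⟨h₀, h⟩ ψ' ⟨h₀', h'⟩ a b ha hb hab
  refine ⟨by simp [h₀, h₀'], fun y y' => ?_⟩
  have h₁ := mul_le_mul_of_nonneg_left (h y y') ha
  have h₂ := mul_le_mul_of_nonneg_left (h' y y') hb
  simp only [ContinuousMap.add_apply, ContinuousMap.smul_apply, smul_eq_mul]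
  calc _ = a * (ψ y - ψ y') + b * (ψ' y - ψ' y') := by ring
    _ ≤ _ := add_le_add h₁ h₂
    _ = _ := by rw [← add_mul, hab, one_mul]

theorem isClosed_normalizedPotentials (x₀ : Ω) : IsClosed (normalizedPotentials x₀) := by
  simp only [normalizedPotentials, Set.ofPred_and, Set.ofPred_forall]
  refine (isClosed_eq (by fun_prop) continuous_const).inter
    (isClosed_iInter fun y => isClosed_iInter fun y' => isClosed_le (by fun_prop) continuous_const)

variable [CompactSpace Ω]

theorem cost_sub_cost_le (x y y' : Ω) :
    cost x y - cost x y' ≤ Metric.diam (Set.univ : Set Ω) * dist y y' := by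
  have hb : Bornology.IsBounded (Set.univ : Set Ω) := isCompact_univ.isBounded
  have h₁ := Metric.dist_le_diam_of_mem hb (Set.mem_univ x) (Set.mem_univ y)
  have h₂ := Metric.dist_le_diam_of_mem hb (Set.mem_univ x) (Set.mem_univ y')
  have h₃ : dist x y - dist x y' ≤ dist y y' := by
    linarith [dist_triangle x y' y, dist_comm y y']
  have h₀ : 0 ≤ dist x y + dist x y' := by positivity
  calc cost x y - cost x y' = (dist x y + dist x y') / 2 * (dist x y - dist x y') := by
        unfold cost; ring
    _ ≤ (dist x y + dist x y') / 2 * dist y y' := by gcongr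
    _ ≤ _ := by gcongr; linarith

theorem cTransform_le (ψ : C(Ω, ℝ)) (x y : Ω) : cTransform ψ x ≤ cost x y - ψ y := by
  refine ciInf_le (f := fun y => cost x y - ψ y) ?_ y
  have h : Continuous fun y => cost x y - ψ y :=
    (continuous_cost.comp (Continuous.prodMk_right x)).sub ψ.continuous
  exact (isCompact_range h).bddBelow

theorem dualAdmissible_cTransform (ψ : C(Ω, ℝ)) : DualAdmissible (cTransform ψ) ψ :=
  fun x y => by linarith [cTransform_le ψ x y]

theorem le_cTransform {ψ : C(Ω, ℝ)} {x : Ω} {a : ℝ} (h : ∀ y, a + ψ y ≤ cost x y) :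
    a ≤ cTransform ψ x := by
  have : Nonempty Ω := ⟨x⟩
  exact le_ciInf fun y => by linarith [h y]

theorem cTransform_zero : cTransform (0 : C(Ω, ℝ)) = 0 := by
  ext x
  refine le_antisymm ?_ (le_cTransform fun y => ?_)
  · simpa [cost] using cTransform_le (0 : C(Ω, ℝ)) x x
  · simpa using cost_nonneg x y

theorem lipschitzWith_cTransform : LipschitzWith 1 (cTransform : C(Ω, ℝ) → C(Ω, ℝ)) := by
  refine LipschitzWith.of_dist_le_mul fun ψ ψ' => ?_
  rw [NNReal.coe_one, one_mul, ContinuousMap.dist_le dist_nonneg]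
  have key : ∀ (ψ ψ' : C(Ω, ℝ)) (x : Ω), cTransform ψ x - dist ψ ψ' ≤ cTransform ψ' x := by
    intro ψ ψ' x
    refine le_cTransform fun y => ?_
    have := ContinuousMap.dist_apply_le_dist (f := ψ) (g := ψ') y
    rw [Real.dist_eq, abs_le] at this
    linarith [cTransform_le ψ x y]
  intro x
  rw [Real.dist_eq, abs_le]
  have h₁ := key ψ ψ' x
  have h₂ := key ψ' ψ x
  rw [dist_comm] at h₂
  constructor <;> linarith

theorem norm_cTransform_le (ψ : C(Ω, ℝ)) : ‖cTransform ψ‖ ≤ ‖ψ‖ := by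
  simpa [cTransform_zero] using lipschitzWith_cTransform.dist_le_mul ψ 0

/-- The `c`-transform, an infimum of functions affine in `ψ`, is concave in `ψ`. -/
theorem le_cTransform_combo (ψ₁ ψ₂ : C(Ω, ℝ)) {a b : ℝ} (ha : 0 ≤ a) (hb : 0 ≤ b)
    (hab : a + b = 1) (x : Ω) :
    a * cTransform ψ₁ x + b * cTransform ψ₂ x ≤ cTransform (a • ψ₁ + b • ψ₂) x := by
  refine le_cTransform fun y => ?_
  have h₁ := mul_le_mul_of_nonneg_left (dualAdmissible_cTransform ψ₁ x y) ha
  have h₂ := mul_le_mul_of_nonneg_left (dualAdmissible_cTransform ψ₂ x y) hb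
  have h₃ : a * cost x y + b * cost x y = cost x y := by rw [← add_mul, hab, one_mul]
  simp only [ContinuousMap.add_apply, ContinuousMap.smul_apply, smul_eq_mul]
  linarith

theorem cTransform_sub_const (ψ : C(Ω, ℝ)) (a : ℝ) (x : Ω) :
    cTransform ψ x + a ≤ cTransform (ψ - ContinuousMap.const Ω a) x :=
  le_cTransform fun y => by
    simp only [ContinuousMap.sub_apply, ContinuousMap.const_apply]
    linarith [cTransform_le ψ x y]

theorem cTransform_anti {ψ ψ' : C(Ω, ℝ)} (h : ∀ y, ψ y ≤ ψ' y) (x : Ω) :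
    cTransform ψ' x ≤ cTransform ψ x :=
  le_cTransform fun y => by linarith [cTransform_le ψ' x y, h y]

theorem norm_le_of_mem_normalizedPotentials {x₀ : Ω} {ψ : C(Ω, ℝ)}
    (h : ψ ∈ normalizedPotentials x₀) : ‖ψ‖ ≤ Metric.diam (Set.univ : Set Ω) ^ 2 := by
  rw [ContinuousMap.norm_le _ (by positivity)]
  intro y
  have hb : Bornology.IsBounded (Set.univ : Set Ω) := isCompact_univ.isBounded
  have hd := Metric.dist_le_diam_of_mem hb (Set.mem_univ y) (Set.mem_univ x₀)
  have hd' := mul_le_mul_of_nonneg_left hd (Metric.diam_nonneg (s := (Set.univ : Set Ω)))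
  have h₁ := h.2 y x₀
  have h₂ := h.2 x₀ y
  rw [dist_comm] at h₂
  rw [h.1] at h₁ h₂
  rw [Real.norm_eq_abs, abs_le]
  constructor <;> linarith [sq (Metric.diam (Set.univ : Set Ω))]

theorem isCompact_normalizedPotentials (x₀ : Ω) : IsCompact (normalizedPotentials x₀) := by
  let e := ContinuousMap.isometryEquivBoundedOfCompact Ω ℝ
  rw [← e.toHomeomorph.isCompact_image]
  refine BoundedContinuousFunction.arzela_ascoli₂
    (Metric.closedBall 0 (Metric.diam (Set.univ : Set Ω) ^ 2)) (isCompact_closedBall _ _) _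
    (e.toHomeomorph.isClosed_image.2 (isClosed_normalizedPotentials x₀)) ?_ ?_
  · rintro _ y ⟨ψ, hψ, rfl⟩
    rw [mem_closedBall_zero_iff]
    exact (ψ.norm_coe_le_norm y).trans (norm_le_of_mem_normalizedPotentials hψ)
  · refine (LipschitzWith.uniformEquicontinuous _ (Metric.diam (Set.univ : Set Ω)).toNNReal
      ?_).equicontinuous
    rintro ⟨_, ψ, hψ, rfl⟩
    refine LipschitzWith.of_dist_le_mul fun y y' => ?_
    rw [Real.coe_toNNReal _ Metric.diam_nonneg, Real.dist_eq, abs_le]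
    have h₁ := hψ.2 y y'
    have h₂ := hψ.2 y' y
    rw [dist_comm] at h₂
    change _ ≤ ψ y - ψ y' ∧ ψ y - ψ y' ≤ _
    constructor <;> linarith

end CTransform

/-! ### Decreasing convex sets in a Hilbert space -/

section Hilbert

/-- In a Hilbert space, one can choose a convergent sequence of points in any decreasing sequence of
convex sets, the first of which is bounded: by the parallelogram identity, points of almost minimal
norm form a Cauchy sequence. -/
theorem exists_tendsto_of_antitone_convex {E : Type*} [NormedAddCommGroup E] [InnerProductSpace ℝ E]
    [CompleteSpace E] {C : ℕ → Set E} (hanti : Antitone C) (hconv : ∀ n, Convex ℝ (C n))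
    (hne : ∀ n, (C n).Nonempty) {B : ℝ} (hB : ∀ x ∈ C 0, ‖x‖ ≤ B) :
    ∃ (x : ℕ → E) (a : E), (∀ n, x n ∈ C n) ∧ Tendsto x atTop (𝓝 a) := by
  let S : ℕ → Set ℝ := fun n => (fun x => ‖x‖ ^ 2) '' C n
  let s : ℕ → ℝ := fun n => sInf (S n)
  have hbdd : ∀ n, BddBelow (S n) := fun n => ⟨0, by rintro _ ⟨x, -, rfl⟩; positivity⟩
  have hmono : Monotone s := fun m n hmn =>
    csInf_le_csInf (hbdd m) ((hne n).image _) (Set.image_mono (hanti hmn))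
  have hs_le : ∀ n, ∀ x ∈ C n, s n ≤ ‖x‖ ^ 2 := fun n x hx => csInf_le (hbdd n) ⟨x, hx, rfl⟩
  have hsB : BddAbove (Set.range s) := by
    refine ⟨B ^ 2, ?_⟩
    rintro _ ⟨n, rfl⟩
    obtain ⟨x, hx⟩ := hne n
    have := hB x (hanti (Nat.zero_le n) hx)
    exact (hs_le n x hx).trans (by gcongr)
  have hlim := tendsto_atTop_ciSup hmono hsB
  set t := ⨆ n, s n
  have hst : ∀ n, s n ≤ t := fun n => le_ciSup hsB n
  have hex : ∀ n : ℕ, ∃ x ∈ C n, ‖x‖ ^ 2 < s n + 1 / ((n : ℝ) + 1) := fun n => by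
    obtain ⟨_, ⟨x, hx, rfl⟩, h⟩ := exists_lt_of_csInf_lt ((hne n).image (fun x => ‖x‖ ^ 2))
      (lt_add_of_pos_right (s n) (Nat.one_div_pos_of_nat (n := n)))
    exact ⟨x, hx, h⟩
  choose x hxC hx using hex
  have hcauchy : CauchySeq x := by
    refine cauchySeq_of_le_tendsto_0 (fun N : ℕ => √(4 * (t - s N) + 4 * (1 / ((N : ℝ) + 1))))
      (fun n m N hn hm => ?_) ?_
    · refine Real.le_sqrt_of_sq_le ?_
      have hmid : (1 / 2 : ℝ) • x n + (1 / 2 : ℝ) • x m ∈ C N :=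
        hconv N (hanti hn (hxC n)) (hanti hm (hxC m)) (by norm_num) (by norm_num) (by norm_num)
      have h₁ := hs_le N _ hmid
      rw [← smul_add, norm_smul, mul_pow] at h₁
      norm_num at h₁
      have h₂ := parallelogram_law_with_norm ℝ (x n) (x m)
      have h₃ := Nat.one_div_le_one_div (α := ℝ) hn
      have h₄ := Nat.one_div_le_one_div (α := ℝ) hm
      rw [dist_eq_norm]
      nlinarith [hx n, hx m, hst n, hst m]
    · have : Tendsto (fun N : ℕ => 4 * (t - s N) + 4 * (1 / ((N : ℝ) + 1))) atTop
          (𝓝 (4 * (t - t) + 4 * 0)) :=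
        ((tendsto_const_nhds.sub hlim).const_mul 4).add
          (tendsto_one_div_add_atTop_nhds_zero_nat.const_mul 4)
      simpa using this.sqrt
  obtain ⟨a, ha⟩ := cauchySeq_tendsto_of_complete hcauchy
  exact ⟨x, a, hxC, ha⟩

/-- A separable space carries a finite measure that charges every nonempty open set. -/
theorem exists_isFiniteMeasure_isOpenPosMeasure (X : Type*) [TopologicalSpace X]
    [TopologicalSpace.SeparableSpace X] [Nonempty X] [MeasurableSpace X] [OpensMeasurableSpace X] :
    ∃ m : Measure X, IsFiniteMeasure m ∧ m.IsOpenPosMeasure := by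
  let d : ℕ → X := TopologicalSpace.denseSeq X
  let m : Measure X := Measure.sum fun n => ENNReal.ofReal ((1 / 2) ^ n) • Measure.dirac (d n)
  refine ⟨m, ⟨?_⟩, ⟨fun U hU hne h0 => ?_⟩⟩
  · simp only [m, Measure.sum_apply _ MeasurableSet.univ, Measure.smul_apply, measure_univ,
      smul_eq_mul, mul_one]
    rw [← ENNReal.ofReal_tsum_of_nonneg (fun n => by positivity) summable_geometric_two]
    exact ENNReal.ofReal_lt_top
  · obtain ⟨n, hn⟩ := (TopologicalSpace.denseRange_denseSeq X).exists_mem_open hU hne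
    rw [Measure.sum_apply _ hU.measurableSet, ENNReal.tsum_eq_zero] at h0
    have := h0 n
    rw [Measure.smul_apply, Measure.dirac_apply_of_mem hn] at this
    simp at this

end Hilbert

/-! ### Positive functionals on `C(X)` -/

/-- **Riesz representation** on a compact space: a functional `L ≠ 0` that is nonnegative on
nonnegative functions is a positive multiple of integration against a probability measure. -/
theorem exists_probabilityMeasure_of_nonneg {X : Type*} [TopologicalSpace X] [CompactSpace X]
    [T2Space X] [MeasurableSpace X] [BorelSpace X] (L : C(X, ℝ) →L[ℝ] ℝ)
    (hL : ∀ f : C(X, ℝ), 0 ≤ f → 0 ≤ L f) (hL0 : L ≠ 0) :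
    0 < L 1 ∧ ∃ ν : ProbabilityMeasure X, ∀ f : C(X, ℝ),
      L f = L 1 * ∫ x, f x ∂(ν : Measure X) := by
  have h1 : 0 < L 1 := by
    refine (hL 1 zero_le_one).lt_of_ne' fun h => hL0 ?_
    ext f
    have h₁ := hL (‖f‖ • 1 - f) (fun x => by
      simpa using (le_abs_self _).trans (f.norm_coe_le_norm x))
    have h₂ := hL (‖f‖ • 1 + f) (fun x => by
      have := (abs_le.1 (f.norm_coe_le_norm x)).1
      change 0 ≤ ‖f‖ * 1 + f x
      linarith)
    simp only [map_sub, map_add, map_smul, h, smul_zero] at h₁ h₂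
    simp only [zero_apply]
    linarith
  refine ⟨h1, ?_⟩
  let Λ : CompactlySupportedContinuousMap X ℝ →ₚ[ℝ] ℝ :=
    { toFun := fun f => (L 1)⁻¹ * L f.toContinuousMap
      map_add' := fun f g => by
        rw [← mul_add, ← map_add]; rfl
      map_smul' := fun a f => by
        have : (a • f).toContinuousMap = a • f.toContinuousMap := rfl
        rw [this, map_smul, RingHom.id_apply, smul_eq_mul, smul_eq_mul]; ring
      monotone' := fun f g hfg => by
        have h := hL (g.toContinuousMap - f.toContinuousMap) (fun x => sub_nonneg.2 (hfg x))
        rw [map_sub] at h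
        have := sub_nonneg.1 h
        change (L 1)⁻¹ * L f.toContinuousMap ≤ (L 1)⁻¹ * L g.toContinuousMap
        gcongr }
  have hΛ : ∀ f : C(X, ℝ), ∫ x, f x ∂(RealRMK.rieszMeasure Λ) = (L 1)⁻¹ * L f := fun f =>
    RealRMK.integral_rieszMeasure Λ (CompactlySupportedContinuousMap.continuousMapEquiv f)
  have huniv : (RealRMK.rieszMeasure Λ).real Set.univ = 1 := by
    simpa [h1.ne'] using hΛ 1
  have hp : IsProbabilityMeasure (RealRMK.rieszMeasure Λ) := ⟨by
    have := (ENNReal.toReal_eq_one_iff _).1 huniv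
    exact this⟩
  refine ⟨⟨_, hp⟩, fun f => ?_⟩
  change L f = L 1 * ∫ x, f x ∂(RealRMK.rieszMeasure Λ)
  rw [hΛ, mul_inv_cancel_left₀ h1.ne']

/-! ### The dual functional -/

section DualValue

variable {Ω : Type*} [MetricSpace Ω] [CompactSpace Ω] [MeasurableSpace Ω] [BorelSpace Ω]

theorem ContinuousMap.integrable_probabilityMeasure (ν : ProbabilityMeasure Ω) (f : C(Ω, ℝ)) :
    Integrable f (ν : Measure Ω) :=
  f.continuous.integrable_of_hasCompactSupport (HasCompactSupport.of_compactSpace f)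

/-- Integration against a probability measure, as a continuous linear functional on `C(Ω)`. -/
noncomputable def integralFunctional (ν : ProbabilityMeasure Ω) : C(Ω, ℝ) →L[ℝ] ℝ :=
  LinearMap.mkContinuous
    { toFun := fun f => ∫ x, f x ∂(ν : Measure Ω)
      map_add' := fun f g =>
        integral_add (f.integrable_probabilityMeasure ν) (g.integrable_probabilityMeasure ν)
      map_smul' := fun a f => integral_const_mul a f } 1 fun f => by
    simpa using norm_integral_le_of_norm_le_const (μ := (ν : Measure Ω))
      (Eventually.of_forall f.norm_coe_le_norm)

theorem integralFunctional_apply (ν : ProbabilityMeasure Ω) (f : C(Ω, ℝ)) :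
    integralFunctional ν f = ∫ x, f x ∂(ν : Measure Ω) :=
  rfl

theorem norm_integralFunctional_apply_le (ν : ProbabilityMeasure Ω) (f : C(Ω, ℝ)) :
    ‖integralFunctional ν f‖ ≤ ‖f‖ := by
  rw [integralFunctional_apply]
  simpa using norm_integral_le_of_norm_le_const (μ := (ν : Measure Ω))
      (Eventually.of_forall f.norm_coe_le_norm)

theorem integralFunctional_mono (ν : ProbabilityMeasure Ω) {f g : C(Ω, ℝ)} (h : ∀ x, f x ≤ g x) :
    integralFunctional ν f ≤ integralFunctional ν g :=
  integral_mono (f.integrable_probabilityMeasure ν) (g.integrable_probabilityMeasure ν) h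

theorem integralFunctional_const (ν : ProbabilityMeasure Ω) (a : ℝ) :
    integralFunctional ν (ContinuousMap.const Ω a) = a := by
  simp [integralFunctional_apply]

theorem dualValue_eq (ρ μ : ProbabilityMeasure Ω) (φ ψ : C(Ω, ℝ)) :
    dualValue ρ μ φ ψ = integralFunctional ρ φ + integralFunctional μ ψ :=
  rfl

theorem dualValue_le_wassersteinSq (ρ μ : ProbabilityMeasure Ω) (ψ : C(Ω, ℝ)) :
    dualValue ρ μ (cTransform ψ) ψ ≤ wassersteinSq μ ρ :=
  le_csSup (bddAbove_dualValue μ ρ) ⟨_, _, dualAdmissible_cTransform ψ, rfl⟩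

/-- Replacing an admissible pair by the double `c`-transform, shifted by a constant, does not
decrease the dual value. -/
theorem exists_mem_normalizedPotentials_dualValue_le (x₀ : Ω) {φ ψ : C(Ω, ℝ)}
    (h : DualAdmissible φ ψ) : ∃ ψ' ∈ normalizedPotentials x₀, ∀ ρ μ : ProbabilityMeasure Ω,
      dualValue ρ μ φ ψ ≤ dualValue ρ μ (cTransform ψ') ψ' := by
  set θ := cTransform (cTransform ψ) with hθ
  set a := θ x₀ with ha
  refine ⟨θ - ContinuousMap.const Ω a, ⟨by simp [ha], fun y y' => ?_⟩, fun ρ μ => ?_⟩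
  · have : θ y - Metric.diam (Set.univ : Set Ω) * dist y y' ≤ θ y' := le_cTransform fun x => by
      have h₁ := dualAdmissible_cTransform (cTransform ψ) y x
      have h₂ := cost_sub_cost_le x y y'
      rw [cost_comm x y, cost_comm x y'] at h₂
      linarith
    simp only [ContinuousMap.sub_apply, ContinuousMap.const_apply]
    linarith
  · have h₁ : ∀ x, (φ + ContinuousMap.const Ω a) x ≤
        cTransform (θ - ContinuousMap.const Ω a) x := by
      intro x
      have h₁ : φ x ≤ cTransform ψ x := le_cTransform (h x)
      have h₂ : cTransform ψ x ≤ cTransform θ x := le_cTransform fun y => by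
        have := dualAdmissible_cTransform (cTransform ψ) y x
        rw [cost_comm y x] at this
        linarith
      have h₃ := cTransform_sub_const θ a x
      simp only [ContinuousMap.add_apply, ContinuousMap.const_apply]
      linarith
    have h₂ : ∀ y, ψ y ≤ θ y := fun y => le_cTransform fun x => by
      have := dualAdmissible_cTransform ψ x y
      rw [cost_comm x y] at this
      linarith
    have h₃ := integralFunctional_mono ρ h₁
    have h₄ := integralFunctional_mono μ h₂
    rw [map_add, integralFunctional_const] at h₃
    rw [dualValue_eq, dualValue_eq, map_sub, integralFunctional_const]
    linarith

theorem abs_dualValue_le {x₀ : Ω} {ψ : C(Ω, ℝ)} (hψ : ψ ∈ normalizedPotentials x₀)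
    (ρ μ : ProbabilityMeasure Ω) :
    |dualValue ρ μ (cTransform ψ) ψ| ≤ 2 * Metric.diam (Set.univ : Set Ω) ^ 2 := by
  have h := norm_le_of_mem_normalizedPotentials hψ
  have h₁ := (norm_integralFunctional_apply_le ρ _).trans ((norm_cTransform_le ψ).trans h)
  have h₂ := (norm_integralFunctional_apply_le μ _).trans h
  rw [dualValue_eq, two_mul]
  exact (abs_add_le _ _).trans (add_le_add h₁ h₂)

theorem wassersteinSq_nonneg (μ ρ : ProbabilityMeasure Ω) : 0 ≤ wassersteinSq μ ρ := by
  simpa [dualValue_eq, cTransform_zero] using dualValue_le_wassersteinSq ρ μ 0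

theorem wassersteinSq_le (μ ρ : ProbabilityMeasure Ω) :
    wassersteinSq μ ρ ≤ 2 * Metric.diam (Set.univ : Set Ω) ^ 2 := by
  obtain ⟨x₀⟩ := μ.nonempty
  refine Real.sSup_le ?_ (by positivity)
  rintro _ ⟨φ, ψ, h, rfl⟩
  obtain ⟨ψ', hψ', hle⟩ := exists_mem_normalizedPotentials_dualValue_le x₀ h
  exact (hle ρ μ).trans ((le_abs_self _).trans (abs_dualValue_le hψ' ρ μ))

theorem continuous_dualValue_cTransform (ρ μ : ProbabilityMeasure Ω) :
    Continuous fun ψ : C(Ω, ℝ) => dualValue ρ μ (cTransform ψ) ψ :=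
  ((integralFunctional ρ).continuous.comp lipschitzWith_cTransform.continuous).add
    (integralFunctional μ).continuous

/-- Countably many normalized potentials suffice to compute all Wasserstein distances. -/
theorem exists_seq_lt_dualValue (x₀ : Ω) :
    ∃ d : ℕ → C(Ω, ℝ), (∀ n, d n ∈ normalizedPotentials x₀) ∧
    ∀ (ρ μ : ProbabilityMeasure Ω) (c : ℝ), c < wassersteinSq μ ρ →
      ∃ n, c < dualValue ρ μ (cTransform (d n)) (d n) := by
  have : Nonempty (normalizedPotentials x₀) := ⟨⟨0, zero_mem_normalizedPotentials x₀⟩⟩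
  refine ⟨fun n => TopologicalSpace.denseSeq (normalizedPotentials x₀) n,
    fun n => Subtype.coe_prop _, fun ρ μ c hc => ?_⟩
  have hne : {r : ℝ | ∃ φ ψ : C(Ω, ℝ), DualAdmissible φ ψ ∧ r = dualValue ρ μ φ ψ}.Nonempty :=
    ⟨_, _, _, dualAdmissible_cTransform 0, rfl⟩
  obtain ⟨_, ⟨φ, ψ, h, rfl⟩, hlt⟩ := exists_lt_of_lt_csSup hne hc
  obtain ⟨ψ', hψ', hle⟩ := exists_mem_normalizedPotentials_dualValue_le x₀ h
  have hU : IsOpen {ψ : normalizedPotentials x₀ | c < dualValue ρ μ (cTransform ψ.1) ψ.1} :=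
    isOpen_lt continuous_const
      ((continuous_dualValue_cTransform ρ μ).comp continuous_subtype_val)
  exact (TopologicalSpace.denseRange_denseSeq _).exists_mem_open hU
    ⟨⟨ψ', hψ'⟩, hlt.trans_le (hle ρ μ)⟩

end DualValue

/-! ### Measurable fields of potentials -/

section Selections

variable {Ω : Type*} [MetricSpace Ω] [CompactSpace Ω] [MeasurableSpace Ω]

/-- The measurable fields `ρ ↦ ψ_ρ` of normalized potentials. -/
def potentialSelections (x₀ : Ω) : Set (ProbabilityMeasure Ω → C(Ω, ℝ)) :=
  {ψ | StronglyMeasurable ψ ∧ ∀ ρ, ψ ρ ∈ normalizedPotentials x₀}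

theorem convex_potentialSelections (x₀ : Ω) : Convex ℝ (potentialSelections x₀) :=
  fun _ h _ h' _ _ ha hb hab => ⟨(h.1.const_smul _).add (h'.1.const_smul _),
    fun ρ => convex_normalizedPotentials x₀ (h.2 ρ) (h'.2 ρ) ha hb hab⟩

theorem integrable_of_mem_potentialSelections {x₀ : Ω} {ψ : ProbabilityMeasure Ω → C(Ω, ℝ)}
    (P : ProbabilityMeasure (ProbabilityMeasure Ω)) (hψ : ψ ∈ potentialSelections x₀) :
    Integrable ψ (P : Measure (ProbabilityMeasure Ω)) :=
  Integrable.of_bound hψ.1.aestronglyMeasurable _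
    (Eventually.of_forall fun ρ => norm_le_of_mem_normalizedPotentials (hψ.2 ρ))

variable [BorelSpace Ω]

/-- If `ρ ↦ f_ρ ∈ C(Ω)` is measurable, so is `ρ ↦ ∫ f_ρ dρ`. -/
theorem stronglyMeasurable_integralFunctional {f : ProbabilityMeasure Ω → C(Ω, ℝ)}
    (hf : StronglyMeasurable f) : StronglyMeasurable fun ρ => integralFunctional ρ (f ρ) := by
  let κ : ProbabilityTheory.Kernel (ProbabilityMeasure Ω) Ω :=
    ⟨fun ρ => (ρ : Measure Ω), measurable_subtype_coe⟩
  have : ProbabilityTheory.IsMarkovKernel κ := ⟨fun ρ => ρ.2⟩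
  have hjoint : StronglyMeasurable fun p : ProbabilityMeasure Ω × Ω => f p.1 p.2 := by
    have hc : Continuous fun q : C(Ω, ℝ) × Ω => q.1 q.2 := by fun_prop
    exact hc.comp_stronglyMeasurable
      ((hf.comp_measurable measurable_fst).prodMk measurable_snd.stronglyMeasurable)
  exact hjoint.integral_kernel_prod_right' (κ := κ)

theorem stronglyMeasurable_dualValue (μ : ProbabilityMeasure Ω) {ψ : ProbabilityMeasure Ω → C(Ω, ℝ)}
    (hψ : StronglyMeasurable ψ) :
    StronglyMeasurable fun ρ => dualValue ρ μ (cTransform (ψ ρ)) (ψ ρ) :=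
  (stronglyMeasurable_integralFunctional
    (lipschitzWith_cTransform.continuous.comp_stronglyMeasurable hψ)).add
    ((integralFunctional μ).continuous.comp_stronglyMeasurable hψ)

theorem measurable_wassersteinSq (μ : ProbabilityMeasure Ω) :
    Measurable fun ρ => wassersteinSq μ ρ := by
  obtain ⟨x₀⟩ := μ.nonempty
  obtain ⟨d, -, hlt⟩ := exists_seq_lt_dualValue x₀
  have : (fun ρ => wassersteinSq μ ρ) = fun ρ => ⨆ n, dualValue ρ μ (cTransform (d n)) (d n) := by
    ext ρ
    exact (ciSup_eq_of_forall_le_of_forall_lt_exists_gt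
      (fun n => dualValue_le_wassersteinSq ρ μ (d n)) (fun c hc => hlt ρ μ c hc)).symm
  rw [this]
  exact Measurable.iSup fun n =>
    (stronglyMeasurable_dualValue μ (stronglyMeasurable_const (b := d n))).measurable

theorem integrable_wassersteinSq (P : ProbabilityMeasure (ProbabilityMeasure Ω))
    (μ : ProbabilityMeasure Ω) :
    Integrable (fun ρ => wassersteinSq μ ρ) (P : Measure (ProbabilityMeasure Ω)) :=
  Integrable.of_bound (measurable_wassersteinSq μ).aestronglyMeasurable _
    (Eventually.of_forall fun ρ => by
      rw [Real.norm_of_nonneg (wassersteinSq_nonneg μ ρ)]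
      exact wassersteinSq_le μ ρ)

/-- The functional `∫∫ ψ_ρᶜ dρ dℙ(ρ)` of a field `ρ ↦ ψ_ρ`. -/
noncomputable def transformIntegral (P : ProbabilityMeasure (ProbabilityMeasure Ω))
    (ψ : ProbabilityMeasure Ω → C(Ω, ℝ)) : ℝ :=
  ∫ ρ, integralFunctional ρ (cTransform (ψ ρ)) ∂(P : Measure (ProbabilityMeasure Ω))

variable {x₀ : Ω} {ψ : ProbabilityMeasure Ω → C(Ω, ℝ)}
  (P : ProbabilityMeasure (ProbabilityMeasure Ω))

theorem norm_integralFunctional_cTransform_le (hψ : ψ ∈ potentialSelections x₀)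
    (ρ : ProbabilityMeasure Ω) :
    ‖integralFunctional ρ (cTransform (ψ ρ))‖ ≤ Metric.diam (Set.univ : Set Ω) ^ 2 :=
  (norm_integralFunctional_apply_le ρ _).trans ((norm_cTransform_le _).trans
    (norm_le_of_mem_normalizedPotentials (hψ.2 ρ)))

theorem stronglyMeasurable_integralFunctional_cTransform (hψ : ψ ∈ potentialSelections x₀) :
    StronglyMeasurable fun ρ => integralFunctional ρ (cTransform (ψ ρ)) :=
  stronglyMeasurable_integralFunctional
    (lipschitzWith_cTransform.continuous.comp_stronglyMeasurable hψ.1)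

theorem integrable_integralFunctional_cTransform (hψ : ψ ∈ potentialSelections x₀) :
    Integrable (fun ρ => integralFunctional ρ (cTransform (ψ ρ)))
      (P : Measure (ProbabilityMeasure Ω)) :=
  Integrable.of_bound (stronglyMeasurable_integralFunctional_cTransform hψ).aestronglyMeasurable _
    (Eventually.of_forall (norm_integralFunctional_cTransform_le hψ))

theorem integrable_dualValue (hψ : ψ ∈ potentialSelections x₀) (ν : ProbabilityMeasure Ω) :
    Integrable (fun ρ => dualValue ρ ν (cTransform (ψ ρ)) (ψ ρ))
      (P : Measure (ProbabilityMeasure Ω)) :=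
  (integrable_integralFunctional_cTransform P hψ).add
    ((integralFunctional ν).integrable_comp (integrable_of_mem_potentialSelections P hψ))

theorem integral_dualValue (hψ : ψ ∈ potentialSelections x₀) (ν : ProbabilityMeasure Ω) :
    ∫ ρ, dualValue ρ ν (cTransform (ψ ρ)) (ψ ρ) ∂(P : Measure (ProbabilityMeasure Ω)) =
      transformIntegral P ψ +
        integralFunctional ν (∫ ρ, ψ ρ ∂(P : Measure (ProbabilityMeasure Ω))) := by
  have hi := integrable_of_mem_potentialSelections P hψ
  simp only [dualValue_eq]
  rw [integral_add (integrable_integralFunctional_cTransform P hψ)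
    ((integralFunctional ν).integrable_comp hi), (integralFunctional ν).integral_comp_comm hi]
  rfl

theorem concaveOn_transformIntegral (x₀ : Ω) :
    ConcaveOn ℝ (potentialSelections x₀) (transformIntegral P) := by
  refine ⟨convex_potentialSelections x₀, fun ψ₁ h₁ ψ₂ h₂ a b ha hb hab => ?_⟩
  have h₃ := convex_potentialSelections x₀ h₁ h₂ ha hb hab
  have i₁ := (integrable_integralFunctional_cTransform P h₁).const_mul a
  have i₂ := (integrable_integralFunctional_cTransform P h₂).const_mul b
  simp only [transformIntegral, smul_eq_mul]
  rw [← integral_const_mul, ← integral_const_mul, ← integral_add i₁ i₂]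
  refine integral_mono (i₁.add i₂) (integrable_integralFunctional_cTransform P h₃) fun ρ => ?_
  have := integralFunctional_mono ρ
    (f := a • cTransform (ψ₁ ρ) + b • cTransform (ψ₂ ρ)) (g := cTransform ((a • ψ₁ + b • ψ₂) ρ))
    (le_cTransform_combo (ψ₁ ρ) (ψ₂ ρ) ha hb hab)
  simpa using this

/-- The set of fields whose value `∫∫ ψ_ρᶜ dρ dℙ + ∫ ψ_ρ(y) dℙ` exceeds the function `g` everywhere
is convex, jointly with `g`. -/
theorem combo_lt_transformIntegral_add {ψ₁ ψ₂ : ProbabilityMeasure Ω → C(Ω, ℝ)}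
    (h₁ : ψ₁ ∈ potentialSelections x₀) (h₂ : ψ₂ ∈ potentialSelections x₀) {a b c₁ c₂ : ℝ}
    (ha : 0 ≤ a) (hb : 0 ≤ b) (hab : a + b = 1) (y : Ω)
    (hc₁ : c₁ < transformIntegral P ψ₁ + (∫ ρ, ψ₁ ρ ∂(P : Measure (ProbabilityMeasure Ω))) y)
    (hc₂ : c₂ < transformIntegral P ψ₂ + (∫ ρ, ψ₂ ρ ∂(P : Measure (ProbabilityMeasure Ω))) y) :
    a * c₁ + b * c₂ < transformIntegral P (a • ψ₁ + b • ψ₂) +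
      (∫ ρ, (a • ψ₁ + b • ψ₂) ρ ∂(P : Measure (ProbabilityMeasure Ω))) y := by
  have hI := (concaveOn_transformIntegral P x₀).2 h₁ h₂ ha hb hab
  have i₁ := integrable_of_mem_potentialSelections P h₁
  have i₂ := integrable_of_mem_potentialSelections P h₂
  have hs : ∫ ρ, (a • ψ₁ + b • ψ₂) ρ ∂(P : Measure (ProbabilityMeasure Ω)) =
      a • ∫ ρ, ψ₁ ρ ∂(P : Measure (ProbabilityMeasure Ω)) +
        b • ∫ ρ, ψ₂ ρ ∂(P : Measure (ProbabilityMeasure Ω)) := by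
    rw [← integral_smul, ← integral_smul]
    exact integral_add (i₁.smul a) (i₂.smul b)
  rw [hs]
  simp only [ContinuousMap.add_apply, ContinuousMap.smul_apply, smul_eq_mul] at hI ⊢
  rcases ha.eq_or_lt with rfl | ha
  · obtain rfl : b = 1 := by linarith
    linarith
  · nlinarith [mul_lt_mul_of_pos_left hc₁ ha, mul_le_mul_of_nonneg_left hc₂.le hb]

/-- The variance functional is at most the supremum over measurable fields of potentials of their
dual values: potentials that are optimal up to a given error can be chosen measurably. -/
theorem exists_potentialSelection_lt_of_lt_wassersteinVar (x₀ : Ω) {ν : ProbabilityMeasure Ω}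
    {c : ℝ} (hc : c < wassersteinVar P ν) : ∃ ψ ∈ potentialSelections x₀,
      c < transformIntegral P ψ +
        integralFunctional ν (∫ ρ, ψ ρ ∂(P : Measure (ProbabilityMeasure Ω))) := by
  classical
  obtain ⟨d, hd, hlt⟩ := exists_seq_lt_dualValue x₀
  obtain ⟨ε, hε, hcε⟩ : ∃ ε, 0 < ε ∧ c < wassersteinVar P ν - ε :=
    ⟨(wassersteinVar P ν - c) / 2, by linarith, by linarith⟩
  have hex : ∀ ρ : ProbabilityMeasure Ω, ∃ n,
      wassersteinSq ν ρ - ε < dualValue ρ ν (cTransform (d n)) (d n) :=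
    fun ρ => hlt ρ ν _ (by linarith)
  have hmeas : Measurable fun ρ => Nat.find (hex ρ) := measurable_find hex fun n =>
    measurableSet_lt ((measurable_wassersteinSq ν).sub_const ε)
      (stronglyMeasurable_dualValue ν (stronglyMeasurable_const (b := d n))).measurable
  have hψ : (fun ρ => d (Nat.find (hex ρ))) ∈ potentialSelections x₀ :=
    ⟨(StronglyMeasurable.of_discrete (f := d)).comp_measurable hmeas, fun ρ => hd _⟩
  refine ⟨_, hψ, hcε.trans_le ?_⟩
  rw [← integral_dualValue P hψ ν]
  have hW := integrable_wassersteinSq P ν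
  calc wassersteinVar P ν - ε
      = ∫ ρ, (wassersteinSq ν ρ - ε) ∂(P : Measure (ProbabilityMeasure Ω)) := by
        rw [integral_sub hW (integrable_const _)]
        simp [wassersteinVar]
    _ ≤ _ := integral_mono (hW.sub (integrable_const _)) (integrable_dualValue P hψ ν)
        fun ρ => (Nat.find_spec (hex ρ)).le

end Selections

/-! ### Strong duality and attainment -/

section Minimax

variable {Ω : Type*} [MetricSpace Ω] [CompactSpace Ω] [MeasurableSpace Ω] [BorelSpace Ω]

/-- Minimax: for `c` below the minimum of the variance functional, a single field of potentials has
dual value above `c` at every point mass `δ_y`, hence at every `ν`. Otherwise `c` could be separated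
in `C(Ω)` from the open convex set of functions lying below some `∫∫ ψ_ρᶜ dρ dℙ + ∫ ψ_ρ dℙ`, and the
separating functional would be a probability measure of variance at most `c`. -/
theorem exists_potentialSelection_forall_lt (x₀ : Ω) {P : ProbabilityMeasure (ProbabilityMeasure Ω)}
    {c : ℝ} (hc : ∀ ν, c < wassersteinVar P ν) : ∃ ψ ∈ potentialSelections x₀, ∀ y,
      c < transformIntegral P ψ + (∫ ρ, ψ ρ ∂(P : Measure (ProbabilityMeasure Ω))) y := by
  let h : (ProbabilityMeasure Ω → C(Ω, ℝ)) → C(Ω, ℝ) := fun ψ =>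
    ContinuousMap.const Ω (transformIntegral P ψ) + ∫ ρ, ψ ρ ∂(P : Measure (ProbabilityMeasure Ω))
  let T : Set C(Ω, ℝ) := {g | ∃ ψ ∈ potentialSelections x₀, ∀ y, g y < h ψ y}
  by_contra hcon
  have hcT : ContinuousMap.const Ω c ∉ T := fun ⟨ψ, hψ, hlt⟩ => hcon ⟨ψ, hψ, hlt⟩
  have hconv : Convex ℝ T := by
    rintro g₁ ⟨ψ₁, h₁, hlt₁⟩ g₂ ⟨ψ₂, h₂, hlt₂⟩ a b ha hb hab
    exact ⟨a • ψ₁ + b • ψ₂, convex_potentialSelections x₀ h₁ h₂ ha hb hab, fun y =>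
      combo_lt_transformIntegral_add P h₁ h₂ ha hb hab y (hlt₁ y) (hlt₂ y)⟩
  have hopen : IsOpen T := by
    have : T = ⋃ ψ ∈ potentialSelections x₀,
        (fun g => h ψ - g) ⁻¹' {f : C(Ω, ℝ) | Set.MapsTo f Set.univ (Set.Ioi 0)} := by
      ext g
      simp [T, Set.MapsTo]
    rw [this]
    exact isOpen_biUnion fun ψ _ =>
      (ContinuousMap.isOpen_setOfPred_mapsTo isCompact_univ isOpen_Ioi).preimage (by fun_prop)
  obtain ⟨L, hL⟩ := geometric_hahn_banach_open_point hconv hopen hcT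
  have hmem : ∀ ψ ∈ potentialSelections x₀, ∀ f : C(Ω, ℝ), (∀ y, 0 < f y) → h ψ - f ∈ T :=
    fun ψ hψ f hf => ⟨ψ, hψ, fun y => by simpa using hf y⟩
  have h0 : (0 : ProbabilityMeasure Ω → C(Ω, ℝ)) ∈ potentialSelections x₀ :=
    ⟨stronglyMeasurable_const, fun _ => zero_mem_normalizedPotentials x₀⟩
  -- `T` is stable under decreasing its elements, so `L` is nonnegative.
  have hpos : ∀ f : C(Ω, ℝ), 0 ≤ f → 0 ≤ L f := by
    intro f hf
    by_contra! hneg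
    have key : ∀ t : ℝ, 0 ≤ t → L (h 0 - 1) - t * L f <
        L (ContinuousMap.const Ω c) := fun t ht => by
      have := hL _ (hmem 0 h0 (1 + t • f) fun y => by
        have := mul_nonneg ht (hf y)
        simp only [ContinuousMap.add_apply, ContinuousMap.one_apply, ContinuousMap.smul_apply,
          smul_eq_mul]
        exact add_pos_of_pos_of_nonneg one_pos this)
      simp only [map_sub, map_add, map_smul, smul_eq_mul] at this ⊢
      linarith
    have hk0 := key 0 le_rfl
    have := key ((L (ContinuousMap.const Ω c) - L (h 0 - 1)) / -(L f))
      (div_nonneg (by linarith) (by linarith))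
    rw [div_neg, neg_mul, div_mul_cancel₀ _ hneg.ne] at this
    linarith
  have hL0 : L ≠ 0 := by
    rintro rfl
    simpa using hL _ (hmem 0 h0 1 fun _ => one_pos)
  obtain ⟨hL1, ν, hν⟩ := exists_probabilityMeasure_of_nonneg L hpos hL0
  obtain ⟨ψ, hψ, hlt⟩ := exists_potentialSelection_lt_of_lt_wassersteinVar P x₀ (hc ν)
  -- A small decrease of `h ψ` puts it into `T` and keeps its integral above `c`.
  set δ : ℝ := (integralFunctional ν (h ψ) - c) / 2 with hδ
  have hint : integralFunctional ν (h ψ) = transformIntegral P ψ +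
      integralFunctional ν (∫ ρ, ψ ρ ∂(P : Measure (ProbabilityMeasure Ω))) := by
    rw [map_add, integralFunctional_const]
  have hδ0 : 0 < δ := by rw [hδ, hint]; linarith
  have := hL _ (hmem ψ hψ (ContinuousMap.const Ω δ) fun _ => hδ0)
  rw [hν, hν (ContinuousMap.const Ω c), ← integralFunctional_apply, ← integralFunctional_apply,
    map_sub, integralFunctional_const, integralFunctional_const, mul_lt_mul_iff_right₀ hL1] at this
  linarith

/-- A decreasing sequence of nonempty convex sets of fields of potentials has a sequence of elements
converging almost everywhere. With `m` a finite measure charging all open sets, `C(Ω)` embeds into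
`L²(m)`, homeomorphically on the compact set of normalized potentials, and convex sets of fields are
sets in the Hilbert space `L²(ℙ; L²(m))`. -/
theorem exists_ae_tendsto_of_antitone_convex {x₀ : Ω}
    (P : ProbabilityMeasure (ProbabilityMeasure Ω)) {A : ℕ → Set (ProbabilityMeasure Ω → C(Ω, ℝ))}
    (hA : ∀ n, A n ⊆ potentialSelections x₀) (hanti : Antitone A) (hconv : ∀ n, Convex ℝ (A n))
    (hne : ∀ n, (A n).Nonempty) :
    ∃ (u : ℕ → ProbabilityMeasure Ω → C(Ω, ℝ)) (ψ : ProbabilityMeasure Ω → C(Ω, ℝ)),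
      (∀ n, u n ∈ A n) ∧ ψ ∈ potentialSelections x₀ ∧
      ∀ᵐ ρ ∂(P : Measure (ProbabilityMeasure Ω)), Tendsto (fun n => u n ρ) atTop (𝓝 (ψ ρ)) := by
  classical
  have : Nonempty Ω := ⟨x₀⟩
  obtain ⟨m, hm, hm'⟩ := exists_isFiniteMeasure_isOpenPosMeasure Ω
  let ι : C(Ω, ℝ) →L[ℝ] Lp ℝ 2 m := ContinuousMap.toLp 2 m ℝ
  have hι : Function.Injective ι := ContinuousMap.toLp_injective m
  let K := normalizedPotentials x₀
  have : CompactSpace K := isCompact_iff_compactSpace.1 (isCompact_normalizedPotentials x₀)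
  have hemb : IsClosedEmbedding fun f : K => ι f :=
    (ι.continuous.comp continuous_subtype_val).isClosedEmbedding
      (hι.comp Subtype.val_injective)
  let Q : Measure (ProbabilityMeasure Ω) := (P : Measure (ProbabilityMeasure Ω))
  have hbound : ∀ ψ ∈ potentialSelections x₀, ∀ ρ,
      ‖ι (ψ ρ)‖ ≤ ‖ι‖ * Metric.diam (Set.univ : Set Ω) ^ 2 := fun ψ hψ ρ =>
    (ι.le_opNorm _).trans (by gcongr; exact norm_le_of_mem_normalizedPotentials (hψ.2 ρ))
  have hmemLp : ∀ ψ ∈ potentialSelections x₀, MemLp (fun ρ => ι (ψ ρ)) 2 Q := fun ψ hψ =>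
    MemLp.of_bound (ι.continuous.comp_aestronglyMeasurable hψ.1.aestronglyMeasurable) _
      (Eventually.of_forall (hbound ψ hψ))
  let S : ℕ → Set (Lp (Lp ℝ 2 m) 2 Q) := fun n => {f | ∃ ψ ∈ A n, f =ᵐ[Q] fun ρ => ι (ψ ρ)}
  have hSne : ∀ n, (S n).Nonempty := fun n => by
    obtain ⟨ψ, hψ⟩ := hne n
    exact ⟨(hmemLp ψ (hA n hψ)).toLp _, ψ, hψ, MemLp.coeFn_toLp _⟩
  have hSconv : ∀ n, Convex ℝ (S n) := by
    rintro n f ⟨ψ, hψ, hf⟩ g ⟨ψ', hψ', hg⟩ a b ha hb hab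
    refine ⟨a • ψ + b • ψ', hconv n hψ hψ' ha hb hab, ?_⟩
    filter_upwards [hf, hg, Lp.coeFn_add (a • f) (b • g), Lp.coeFn_smul a f, Lp.coeFn_smul b g]
      with ρ h₁ h₂ h₃ h₄ h₅
    rw [h₃, Pi.add_apply, h₄, h₅, Pi.smul_apply, Pi.smul_apply, h₁, h₂]
    simp
  have hSbound : ∀ f ∈ S 0, ‖f‖ ≤ ‖ι‖ * Metric.diam (Set.univ : Set Ω) ^ 2 := by
    rintro f ⟨ψ, hψ, hf⟩
    have := Lp.norm_le_of_ae_bound (f := f) (p := 2)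
      (C := ‖ι‖ * Metric.diam (Set.univ : Set Ω) ^ 2) (by positivity) (by
        filter_upwards [hf] with ρ h
        rw [h]
        exact hbound ψ (hA 0 hψ) ρ)
    simpa [measureUnivNNReal, Q] using this
  obtain ⟨f, g, hfS, hfg⟩ := exists_tendsto_of_antitone_convex (C := S)
    (fun n k hnk f ⟨ψ, hψ, h⟩ => ⟨ψ, hanti hnk hψ, h⟩) hSconv hSne hSbound
  choose v hvA hv using hfS
  obtain ⟨ns, hns, hae⟩ := (tendstoInMeasure_of_tendsto_Lp hfg).exists_seq_tendsto_ae
  have hvK : ∀ n ρ, v n ρ ∈ K := fun n ρ => (hA n (hvA n)).2 ρ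
  have hlim : ∀ᵐ ρ ∂Q, ∃ w ∈ K, Tendsto (fun n => v (ns n) ρ) atTop (𝓝 w) := by
    filter_upwards [hae, ae_all_iff.2 hv] with ρ h₁ h₂
    simp only [h₂] at h₁
    obtain ⟨w, hw⟩ := hemb.isClosed_range.mem_of_tendsto h₁
      (Eventually.of_forall fun n => ⟨⟨v (ns n) ρ, hvK _ ρ⟩, rfl⟩)
    refine ⟨w, w.2, ?_⟩
    rw [← hw] at h₁
    have := (hemb.isInducing.tendsto_nhds_iff (f := fun n => (⟨v (ns n) ρ, hvK _ ρ⟩ : K))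
      (l := atTop) (y := w)).2 h₁
    exact (continuous_subtype_val.tendsto w).comp this
  obtain ⟨w, hwm, hw⟩ := exists_stronglyMeasurable_limit_of_tendsto_ae
    (fun n => (hA _ (hvA (ns n))).1.aestronglyMeasurable)
    (hlim.mono fun ρ ⟨w, _, h⟩ => ⟨w, h⟩)
  borelize C(Ω, ℝ)
  have hs : MeasurableSet {ρ | w ρ ∈ K} :=
    hwm.measurable (isClosed_normalizedPotentials x₀).measurableSet
  refine ⟨fun n => v (ns n), fun ρ => if w ρ ∈ K then w ρ else 0,
    fun n => hanti (hns.id_le n) (hvA (ns n)), ⟨?_, fun ρ => ?_⟩, ?_⟩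
  · exact StronglyMeasurable.ite hs hwm stronglyMeasurable_const
  · dsimp only
    split_ifs with h
    · exact h
    · exact zero_mem_normalizedPotentials x₀
  · filter_upwards [hw, hlim] with ρ h₁ ⟨w', hw'K, h₂⟩
    obtain rfl := tendsto_nhds_unique h₁ h₂
    rwa [if_pos hw'K]

/-- Attainment in the dual problem: some field of potentials has dual value at least `c` at every
point mass, for `c` at most the minimum of the variance functional. -/
theorem exists_potentialSelection_forall_le (x₀ : Ω) {P : ProbabilityMeasure (ProbabilityMeasure Ω)}
    {c : ℝ} (hc : ∀ ν, c ≤ wassersteinVar P ν) : ∃ ψ ∈ potentialSelections x₀, ∀ y,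
      c ≤ transformIntegral P ψ + (∫ ρ, ψ ρ ∂(P : Measure (ProbabilityMeasure Ω))) y := by
  let A : ℕ → Set (ProbabilityMeasure Ω → C(Ω, ℝ)) := fun n => {ψ | ψ ∈ potentialSelections x₀ ∧
    ∀ y, c - 1 / ((n : ℝ) + 1) <
      transformIntegral P ψ + (∫ ρ, ψ ρ ∂(P : Measure (ProbabilityMeasure Ω))) y}
  obtain ⟨u, ψ, huA, hψ, hlim⟩ := exists_ae_tendsto_of_antitone_convex (x₀ := x₀) P (A := A)
    (fun n ψ h => h.1)
    (fun n k hnk ψ h => ⟨h.1, fun y => lt_of_le_of_lt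
      (sub_le_sub_left (Nat.one_div_le_one_div hnk) c) (h.2 y)⟩)
    (fun n ψ h ψ' h' a b ha hb hab => ⟨convex_potentialSelections x₀ h.1 h'.1 ha hb hab, fun y => by
      have := combo_lt_transformIntegral_add P h.1 h'.1 ha hb hab y (h.2 y) (h'.2 y)
      rwa [← add_mul, hab, one_mul] at this⟩)
    (fun n => exists_potentialSelection_forall_lt x₀ fun ν =>
      (sub_lt_self c Nat.one_div_pos_of_nat).trans_le (hc ν))
  refine ⟨ψ, hψ, fun y => ?_⟩
  have h₁ : Tendsto (fun n => transformIntegral P (u n)) atTop (𝓝 (transformIntegral P ψ)) := by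
    refine tendsto_integral_of_dominated_convergence (fun _ => Metric.diam (Set.univ : Set Ω) ^ 2)
      (fun n => (stronglyMeasurable_integralFunctional_cTransform (huA n).1).aestronglyMeasurable)
      (integrable_const _)
      (fun n => Eventually.of_forall (norm_integralFunctional_cTransform_le (huA n).1)) ?_
    filter_upwards [hlim] with ρ h
    exact (((integralFunctional ρ).continuous.comp
      lipschitzWith_cTransform.continuous).tendsto _).comp h
  have h₂ : Tendsto (fun n => ∫ ρ, u n ρ ∂(P : Measure (ProbabilityMeasure Ω))) atTop
      (𝓝 (∫ ρ, ψ ρ ∂(P : Measure (ProbabilityMeasure Ω)))) :=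
    tendsto_integral_of_dominated_convergence (fun _ => Metric.diam (Set.univ : Set Ω) ^ 2)
      (fun n => (huA n).1.1.aestronglyMeasurable) (integrable_const _)
      (fun n => Eventually.of_forall fun ρ => norm_le_of_mem_normalizedPotentials ((huA n).1.2 ρ))
      hlim
  have h₃ : Tendsto (fun n : ℕ => c - 1 / ((n : ℝ) + 1)) atTop (𝓝 (c - 0)) :=
    tendsto_const_nhds.sub tendsto_one_div_add_atTop_nhds_zero_nat
  rw [sub_zero] at h₃
  exact le_of_tendsto_of_tendsto' h₃
    (h₁.add (((ContinuousEvalConst.continuous_eval_const (F := C(Ω, ℝ)) y).tendsto _).comp h₂))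
    fun n => ((huA n).2 y).le

end Minimax

/-! ### The zero-order balance at a barycenter -/

/-- `ℙ` is a probability measure on the space `𝒫(Ω)` of Borel probability measures of a compact
metric space `Ω`, and `μ` is a barycenter of `ℙ`. The measurable structure of `𝒫(Ω)` is generated
by the evaluations `ρ ↦ ρ(A)`, which is the Borel σ-algebra of the topology of weak convergence,
that is, of `W₂`. `ℙ`-measurability of `ρ ↦ ψ_ρ ∈ C(Ω)` is measurability up to a `ℙ`-null set. -/
theorem propositionA1 {Ω : Type*} [MetricSpace Ω] [CompactSpace Ω] [MeasurableSpace Ω]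
    [BorelSpace Ω] (P : ProbabilityMeasure (ProbabilityMeasure Ω)) (μ : ProbabilityMeasure Ω)
    (hμ : IsWassersteinBarycenter P μ) :
    ∃ ψ : ProbabilityMeasure Ω → C(Ω, ℝ),
      AEStronglyMeasurable ψ (P : Measure (ProbabilityMeasure Ω)) ∧
      (∀ᵐ ρ ∂(P : Measure (ProbabilityMeasure Ω)),
        IsKantorovichPair ρ μ (cTransform (ψ ρ)) (ψ ρ)) ∧
      (∀ y : Ω, Integrable (fun ρ => ψ ρ y) (P : Measure (ProbabilityMeasure Ω)) ∧
        ∫ ρ, ψ ρ y ∂(P : Measure (ProbabilityMeasure Ω)) = 0) := by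
  obtain ⟨x₀⟩ := μ.nonempty
  obtain ⟨ψ, hψ, hle⟩ := exists_potentialSelection_forall_le x₀ hμ
  set Ψ : C(Ω, ℝ) := ∫ ρ, ψ ρ ∂(P : Measure (ProbabilityMeasure Ω)) with hΨ
  have hi := integrable_of_mem_potentialSelections P hψ
  -- The total dual value of `ψ` at `μ` is at least the variance, so `ψ_ρ` is optimal a.e.
  have hint : wassersteinVar P μ ≤ transformIntegral P ψ + integralFunctional μ Ψ := by
    have := integralFunctional_mono μ (f := ContinuousMap.const Ω (wassersteinVar P μ))
      (g := ContinuousMap.const Ω (transformIntegral P ψ) + Ψ) hle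
    rwa [map_add, integralFunctional_const, integralFunctional_const] at this
  have hd := integrable_dualValue P hψ μ
  have hW := integrable_wassersteinSq P μ
  have hgap : 0 ≤ fun ρ => wassersteinSq μ ρ - dualValue ρ μ (cTransform (ψ ρ)) (ψ ρ) :=
    fun ρ => sub_nonneg.2 (dualValue_le_wassersteinSq ρ μ (ψ ρ))
  have hgap_int : ∫ ρ, (wassersteinSq μ ρ - dualValue ρ μ (cTransform (ψ ρ)) (ψ ρ))
      ∂(P : Measure (ProbabilityMeasure Ω)) =
      wassersteinVar P μ - (transformIntegral P ψ + integralFunctional μ Ψ) := by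
    rw [integral_sub hW hd, integral_dualValue P hψ μ]
    rfl
  have hgap_nonneg := integral_nonneg (μ := (P : Measure (ProbabilityMeasure Ω))) hgap
  have hmean : integralFunctional μ Ψ = wassersteinVar P μ - transformIntegral P ψ := by linarith
  have hopt := (integral_eq_zero_iff_of_nonneg hgap (hW.sub hd)).1 (by rw [hgap_int]; linarith)
  -- `Ψ` is at least its `μ`-average, so subtracting it from `ψ_ρ` keeps the pair optimal.
  have hΨ_le : ∀ y, integralFunctional μ Ψ ≤ Ψ y := fun y => by linarith [hle y]
  refine ⟨fun ρ => ψ ρ - Ψ, (hi.sub (integrable_const Ψ)).aestronglyMeasurable, ?_, fun y => ?_⟩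
  · filter_upwards [hopt] with ρ h
    refine ⟨dualAdmissible_cTransform _, (dualValue_le_wassersteinSq ρ μ _).antisymm ?_, rfl⟩
    have h₁ := integralFunctional_mono ρ
      (f := cTransform (ψ ρ) + ContinuousMap.const Ω (integralFunctional μ Ψ))
      (g := cTransform (ψ ρ - Ψ)) fun x => (cTransform_sub_const (ψ ρ) _ x).trans
        (cTransform_anti (fun y => sub_le_sub_left (hΨ_le y) _) x)
    rw [map_add, integralFunctional_const] at h₁
    have h₂ : wassersteinSq μ ρ - dualValue ρ μ (cTransform (ψ ρ)) (ψ ρ) = 0 := h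
    rw [dualValue_eq] at h₂ ⊢
    rw [map_sub]
    linarith
  · let ev : C(Ω, ℝ) →L[ℝ] ℝ := ContinuousMap.evalCLM ℝ y
    have hi' := hi.sub (integrable_const Ψ)
    refine ⟨ev.integrable_comp hi', (ev.integral_comp_comm hi').trans ?_⟩
    have : ∫ ρ, (ψ ρ - Ψ) ∂(P : Measure (ProbabilityMeasure Ω)) = 0 := by
      rw [integral_sub hi (integrable_const Ψ), ← hΨ]
      simp
    exact (congrArg ev this).trans (map_zero ev)
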